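/- Let $d\ge 1$, let $\mathbb{T}^d=\mathbb{R}^d/\mathbb{Z}^d$ be the unit torus, and let $\mathcal{Y}^d=[0,1)^d$. Let $V:\mathbb{T}^d\times\mathbb{R}^d\to\mathbb{R}$, $(x,y)\mapsto V(x,y)$, be a smooth function that is $\mathcal{Y}^d$-periodic in $y$ (that is, $1$-periodic in each coordinate of $y$). If $d>1$, assume further that $V$ is separable in $y$: there are smooth functions $V_i:\mathbb{T}^d\times\mathbb{R}\to\mathbb{R}$, $1\le i\le d$, with $$V(x,y)=\sum_{i=1}^d V_i(x,y_i)\qquad\text{for all } x\in\mathbb{T}^d,\ y\in\mathbb{R}^d .$$ Let $\alpha\in(0,1)$ and suppose that, for every $x\in\mathbb{T}^d$ and $\Lambda\in\mathbb{R}^d$, the $\mathcal{Y}^d$-periodic functions $\widetilde w(x,\Lambda,\cdot)\in C^{2,\alpha}(\mathbb{R}^d)$ (determined up to an additive constant) and $\widetilde m(x,\Lambda,\cdot)\in C^{1,\alpha}(\mathbb{R}^d)$, $\widetilde m>0$, and the number $\widetilde H(x,\Lambda)\in\mathbb{R}$ solve the cell problem $$\begin{cases} \dfrac{|\Lambda+\nabla_y\widetilde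 w(x,\Lambda,y)|^2}{2}+V(x,y)=\ln\widetilde m(x,\Lambda,y)+\widetilde H(x,\Lambda), & y\in\mathcal{Y}^d,\\[1ex] -\operatorname{div}_y\big(\widetilde m(x,\Lambda,y)\,(\Lambda+\nabla_y\widetilde w(x,\Lambda,y))\big)=0, & y\in\mathcal{Y}^d,\\[1ex] \displaystyle\int_{\mathcal{Y}^d}\widetilde m(x,\Lambda,y)\,dy=1. & \end{cases}$$ Then, for every $x\in\mathbb{T}^d$, the function $\Lambda\mapsto\widetilde H(x,\Lambda)$ is twice continuously differentiable, and $\widetilde H$ is uniformly convex in $\Lambda$: there exists a constant $C>0$, independent of $x$, $\Lambda$ and $\xi$, such that $$\sum_{j,l=1}^d \xi_j\,\frac{\partial^2\widetilde H}{\partial\Lambda_j\,\partial\Lambda_l}(x,\Lambda)\,\xi_l\ \ge\ C\,|\xi|^2\qquad\text{for all } x\in\mathbb{T}^d,\ \Lambda\in\mathbb{R}^d,\ \xi\in\mathbb{R}^d .$$ -/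

import Mathlib

open scoped NNReal ContDiff

noncomputable section

namespace CellProblem

/-- `ℝ^d` with the Euclidean norm. -/
abbrev E (d : ℕ) : Type := EuclideanSpace ℝ (Fin d)

/-- The `i`-th vector of the canonical basis of `ℝ^d`. -/
def e {d : ℕ} (i : Fin d) : E d := EuclideanSpace.single i (1 : ℝ)

/-- The unit cell `[0,1)^d`. -/
def unitCell (d : ℕ) : Set (E d) := {y | ∀ i, y i ∈ Set.Ico (0 : ℝ) 1}

/-- `f` is `1`-periodic in each coordinate; such functions are the functions on the unit torus
`ℝ^d / ℤ^d`. -/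
def CellPeriodic {d : ℕ} {X : Type*} (f : E d → X) : Prop :=
  ∀ i : Fin d, Function.Periodic f (e i)

/-- `f` belongs to the space of periodic `C^{k,α}` functions on the unit cell. (The derivatives
of order at most `k` are bounded, by continuity and periodicity.) -/
def PeriodicHolder {d : ℕ} (k : ℕ) (α : ℝ≥0) (f : E d → ℝ) : Prop :=
  CellPeriodic f ∧ ContDiff ℝ k f ∧ ∃ K : ℝ≥0, HolderWith K α (iteratedFDeriv ℝ k f)

/-- Divergence of a vector field on `ℝ^d`: the sum over `i` of `∂_i F_i`. -/
def divergence {d : ℕ} (F : E d → E d) (y : E d) : ℝ :=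
  ∑ i : Fin d, fderiv ℝ (fun z => F z i) y (e i)

/-- An admissible potential: `V : T^d × ℝ^d → ℝ` is smooth and periodic in the second variable
(functions of `x` on the torus `T^d` are identified with periodic functions on `ℝ^d`). -/
structure IsPotential {d : ℕ} (V : E d → E d → ℝ) : Prop where
  smooth : ContDiff ℝ ∞ (fun p : E d × E d => V p.1 p.2)
  periodic_x : CellPeriodic V
  periodic_y : ∀ x, CellPeriodic (V x)

/-- `V` is separable in `y`: `V(x,y) = ∑ i, V_i(x, y_i)` with smooth `V_i : T^d × ℝ → ℝ`. -/
def IsSeparable {d : ℕ} (V : E d → E d → ℝ) : Prop :=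
  ∃ W : Fin d → E d → ℝ → ℝ,
    (∀ i, ContDiff ℝ ∞ (fun p : E d × ℝ => W i p.1 p.2)) ∧
    (∀ i, CellPeriodic (W i)) ∧
    ∀ x y, V x y = ∑ i : Fin d, W i x (y i)

/-- `(w, m, h)` is a solution of the cell problem with potential `v = V(x, ·)` and vector `Λ`, in
the class `w ∈ C^{2,α}`, `m ∈ C^{1,α}` of periodic functions, with `m > 0`.
The function `w` stands for its class modulo additive constants. -/
structure IsCellSolution {d : ℕ} (α : ℝ≥0) (v : E d → ℝ) (Λ : E d)
    (w m : E d → ℝ) (h : ℝ) : Prop where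
  w_holder : PeriodicHolder 2 α w
  m_holder : PeriodicHolder 1 α m
  m_pos : ∀ y, 0 < m y
  hamiltonJacobi : ∀ y, ‖Λ + gradient w y‖ ^ 2 / 2 + v y = Real.log (m y) + h
  transport : ∀ y, -divergence (fun z => m z • (Λ + gradient w z)) y = 0
  mass : ∫ y in unitCell d, m y = 1

/-- The second partial derivative `∂²f / ∂Λ_j ∂Λ_l` at `Λ`. -/
def secondPartial {d : ℕ} (f : E d → ℝ) (Λ : E d) (j l : Fin d) : ℝ :=
  iteratedFDeriv ℝ 2 f Λ ![e j, e l]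

end CellProblem

end

namespace CellProblem

open Filter Topology MeasureTheory Set

/-! The number `H x Λ` is determined by the cell problem, so it can be computed from any solution.
For uniqueness (`IsClassicalSolution.le`), note that `e^h m = exp (|P|²/2 + v)` with `P = Λ + ∇w`, a
convex function of `P`. Its tangent inequality between two solutions, integrated over the cell,
loses its linear term by the transport equation and compares the two values of `h`.

For separable `V` a solution splits into one-dimensional ones, so `H x Λ = ∑ i, h_i (Λ_i)` and the
Hessian is diagonal. In dimension one the flux `m p = c` is constant, and with `k = c e^h` the
equation becomes `p exp (p²/2) = k exp (-v)`. This gives `p` as a function of `k`. The mean of `p`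
is an increasing bijection `k ↦ Λ`, and `e^h` is the integral `Z` of `exp (p²/2 + v)`.
Differentiating yields `h' = k / Z = c` and `h'' = (dk/dΛ) / Z - c²`.

The convexity constant comes from `exp_le_second_derivative`: `h''` is at least the square of a
lower bound for `m`, and such a bound depends only on the oscillation of `v`, which is uniform in
`x` by compactness of the torus. -/

theorem exists_inverse_of_deriv_pos {f f' : ℝ → ℝ} (hf : ∀ x, HasDerivAt f (f' x) x)
    (hpos : ∀ x, 0 < f' x) (htop : Tendsto f atTop atTop) (hbot : Tendsto f atBot atBot) :
    ∃ g : ℝ → ℝ, Continuous g ∧ Monotone g ∧ Tendsto g atTop atTop ∧ Tendsto g atBot atBot ∧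
      (∀ y, f (g y) = y) ∧ ∀ y, HasDerivAt g (f' (g y))⁻¹ y := by
  have hcont : Continuous f := continuous_iff_continuousAt.2 fun x => (hf x).continuousAt
  have hmono : StrictMono f := strictMono_of_deriv_pos fun x => by
    rw [(hf x).deriv]; exact hpos x
  let φ : ℝ ≃o ℝ := hmono.orderIsoOfSurjective f (hcont.surjective htop hbot)
  have hinv : ∀ y, f (φ.symm y) = y := fun y => φ.apply_symm_apply y
  refine ⟨φ.symm, φ.symm.continuous, φ.symm.monotone, φ.symm.tendsto_atTop,
    φ.symm.tendsto_atBot, hinv, fun y => ?_⟩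
  exact HasDerivAt.of_local_left_inverse φ.symm.continuous.continuousAt (hf _)
    (hpos _).ne' (Eventually.of_forall hinv)

/-! ### The inverse of `p ↦ p exp (p²/2)`. -/

theorem hasDerivAt_mul_exp_sq (p : ℝ) :
    HasDerivAt (fun p : ℝ => p * Real.exp (p ^ 2 / 2)) ((1 + p ^ 2) * Real.exp (p ^ 2 / 2)) p := by
  have h1 : HasDerivAt (fun p : ℝ => p ^ 2 / 2) p p := by
    simpa using ((hasDerivAt_id p).pow 2).div_const 2
  refine ((hasDerivAt_id p).mul h1.exp).congr_deriv ?_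
  simp only [id]; ring

theorem exists_inverse_mul_exp_sq :
    ∃ g : ℝ → ℝ, Continuous g ∧ Monotone g ∧ Tendsto g atTop atTop ∧ Tendsto g atBot atBot ∧
      (∀ s, g s * Real.exp (g s ^ 2 / 2) = s) ∧
      ∀ s, HasDerivAt g ((1 + g s ^ 2) * Real.exp (g s ^ 2 / 2))⁻¹ s := by
  have hexp : ∀ p : ℝ, 1 ≤ Real.exp (p ^ 2 / 2) := fun p => Real.one_le_exp (by positivity)
  refine exists_inverse_of_deriv_pos hasDerivAt_mul_exp_sq (fun x => by positivity) ?_ ?_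
  · refine tendsto_atTop_mono' _ ?_ tendsto_id
    filter_upwards [eventually_ge_atTop 0] with p hp
    exact le_mul_of_one_le_right hp (hexp p)
  · refine tendsto_atBot_mono' _ ?_ tendsto_id
    filter_upwards [eventually_le_atBot 0] with p hp
    simp only [id]
    nlinarith [hexp p]

/-- The inverse function of `p ↦ p * exp (p ^ 2 / 2)`. -/
noncomputable def invMulExpSq : ℝ → ℝ := Classical.choose exists_inverse_mul_exp_sq

theorem continuous_invMulExpSq : Continuous invMulExpSq :=
  (Classical.choose_spec exists_inverse_mul_exp_sq).1

theorem monotone_invMulExpSq : Monotone invMulExpSq :=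
  (Classical.choose_spec exists_inverse_mul_exp_sq).2.1

theorem tendsto_invMulExpSq_atTop : Tendsto invMulExpSq atTop atTop :=
  (Classical.choose_spec exists_inverse_mul_exp_sq).2.2.1

theorem tendsto_invMulExpSq_atBot : Tendsto invMulExpSq atBot atBot :=
  (Classical.choose_spec exists_inverse_mul_exp_sq).2.2.2.1

theorem invMulExpSq_mul_exp (s : ℝ) : invMulExpSq s * Real.exp (invMulExpSq s ^ 2 / 2) = s :=
  (Classical.choose_spec exists_inverse_mul_exp_sq).2.2.2.2.1 s

/-- The derivative of `invMulExpSq`. -/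
noncomputable def invMulExpSqDeriv (s : ℝ) : ℝ :=
  ((1 + invMulExpSq s ^ 2) * Real.exp (invMulExpSq s ^ 2 / 2))⁻¹

theorem hasDerivAt_invMulExpSq (s : ℝ) : HasDerivAt invMulExpSq (invMulExpSqDeriv s) s :=
  (Classical.choose_spec exists_inverse_mul_exp_sq).2.2.2.2.2 s

theorem invMulExpSqDeriv_pos (s : ℝ) : 0 < invMulExpSqDeriv s := by
  unfold invMulExpSqDeriv; positivity

theorem invMulExpSqDeriv_le_one (s : ℝ) : invMulExpSqDeriv s ≤ 1 := by
  refine inv_le_one_of_one_le₀ (one_le_mul_of_one_le_of_one_le ?_ (Real.one_le_exp ?_))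
  · nlinarith [sq_nonneg (invMulExpSq s)]
  · positivity

theorem continuous_invMulExpSqDeriv : Continuous invMulExpSqDeriv := by
  have := continuous_invMulExpSq
  refine Continuous.inv₀ (by fun_prop) fun s => by positivity

theorem contDiff_invMulExpSq : ContDiff ℝ 1 invMulExpSq := by
  rw [contDiff_one_iff_deriv]
  refine ⟨fun s => (hasDerivAt_invMulExpSq s).differentiableAt, ?_⟩
  rw [show deriv invMulExpSq = invMulExpSqDeriv from
    funext fun s => (hasDerivAt_invMulExpSq s).deriv]
  exact continuous_invMulExpSqDeriv

/-! ### The one-dimensional cell problem. -/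

section OneDim

/-- For the potential `v`, the total momentum `Λ + w'` of the one-dimensional problem at `t`, as a
function of the parameter `k = c * exp h`, where `c` is the constant flux. -/
noncomputable def momentum (v : ℝ → ℝ) (k t : ℝ) : ℝ := invMulExpSq (k * Real.exp (-v t))

/-- The mean of the momentum. -/
noncomputable def meanMomentum (v : ℝ → ℝ) (k : ℝ) : ℝ := ∫ t in (0 : ℝ)..1, momentum v k t

/-- The derivative of `meanMomentum v`. -/
noncomputable def meanMomentumDeriv (v : ℝ → ℝ) (k : ℝ) : ℝ :=
  ∫ t in (0 : ℝ)..1, Real.exp (-v t) * invMulExpSqDeriv (k * Real.exp (-v t))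

/-- The normalizing factor of the density. -/
noncomputable def partitionFn (v : ℝ → ℝ) (k : ℝ) : ℝ :=
  ∫ t in (0 : ℝ)..1, Real.exp (momentum v k t ^ 2 / 2 + v t)

variable {v : ℝ → ℝ}

theorem momentum_mul_exp (v : ℝ → ℝ) (k t : ℝ) :
    momentum v k t * Real.exp (momentum v k t ^ 2 / 2 + v t) = k := by
  rw [Real.exp_add, ← mul_assoc, momentum, invMulExpSq_mul_exp, mul_assoc, ← Real.exp_add]
  simp

theorem continuous_momentum (hv : Continuous v) (k : ℝ) : Continuous (momentum v k) :=
  continuous_invMulExpSq.comp (by fun_prop)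

theorem hasDerivAt_momentum (v : ℝ → ℝ) (k t : ℝ) :
    HasDerivAt (fun k => momentum v k t)
      (Real.exp (-v t) * invMulExpSqDeriv (k * Real.exp (-v t))) k := by
  have h1 : HasDerivAt (fun k => k * Real.exp (-v t)) (Real.exp (-v t)) k := by
    simpa using (hasDerivAt_id k).mul_const (Real.exp (-v t))
  have := (hasDerivAt_invMulExpSq (k * Real.exp (-v t))).comp k h1
  rw [mul_comm]
  exact this

theorem continuous_momentum_deriv (hv : Continuous v) (k : ℝ) :
    Continuous fun t => Real.exp (-v t) * invMulExpSqDeriv (k * Real.exp (-v t)) := by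
  have := continuous_invMulExpSqDeriv
  fun_prop

theorem hasDerivAt_meanMomentum (hv : Continuous v) (k : ℝ) :
    HasDerivAt (meanMomentum v) (meanMomentumDeriv v k) k := by
  refine (intervalIntegral.hasDerivAt_integral_of_dominated_loc_of_deriv_le
    (F := momentum v) (F' := fun k t => Real.exp (-v t) * invMulExpSqDeriv (k * Real.exp (-v t)))
    (bound := fun t => Real.exp (-v t)) (s := univ) univ_mem ?_ ?_ ?_ ?_ ?_ ?_).2
  · exact Eventually.of_forall fun k => (continuous_momentum hv k).aestronglyMeasurable
  · exact (continuous_momentum hv k).intervalIntegrable _ _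
  · exact (continuous_momentum_deriv hv k).aestronglyMeasurable
  · refine Eventually.of_forall fun t _ k _ => ?_
    have := invMulExpSqDeriv_pos (k * Real.exp (-v t))
    rw [Real.norm_of_nonneg (by positivity)]
    exact mul_le_of_le_one_right (Real.exp_pos _).le (invMulExpSqDeriv_le_one _)
  · exact Continuous.intervalIntegrable (by fun_prop) _ _
  · exact Eventually.of_forall fun t _ k _ => hasDerivAt_momentum v k t

/-- The `k`-derivative of `exp (p²/2 + v)` is `p exp (p²/2 + v) ∂p/∂k`, and `p exp (p²/2 + v) = k`
for every `t`, so `k` comes out of the integral. -/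
theorem hasDerivAt_partitionFn (hv : Continuous v) (k : ℝ) :
    HasDerivAt (partitionFn v) (k * meanMomentumDeriv v k) k := by
  have hc : ∀ k, Continuous fun t => Real.exp (momentum v k t ^ 2 / 2 + v t) := fun k => by
    have := continuous_momentum hv k
    fun_prop
  have key := (intervalIntegral.hasDerivAt_integral_of_dominated_loc_of_deriv_le
    (μ := volume) (a := 0) (b := 1) (x₀ := k)
    (F := fun k t => Real.exp (momentum v k t ^ 2 / 2 + v t))
    (F' := fun k t => k * (Real.exp (-v t) * invMulExpSqDeriv (k * Real.exp (-v t))))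
    (bound := fun t => (|k| + 1) * Real.exp (-v t)) (Metric.ball_mem_nhds k one_pos)
    ?_ ?_ ?_ ?_ ?_ ?_).2
  · rwa [intervalIntegral.integral_const_mul] at key
  · exact Eventually.of_forall fun k => (hc k).aestronglyMeasurable
  · exact (hc k).intervalIntegrable _ _
  · exact (continuous_const.mul (continuous_momentum_deriv hv k)).aestronglyMeasurable
  · refine Eventually.of_forall fun t _ r hr => ?_
    have := invMulExpSqDeriv_pos (r * Real.exp (-v t))
    rw [norm_mul, Real.norm_of_nonneg (r := Real.exp _ * _) (by positivity), Real.norm_eq_abs]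
    have hr' : |r| ≤ |k| + 1 := by
      have h1 : |r - k| < 1 := by simpa [Real.dist_eq] using hr
      have h2 := abs_sub_abs_le_abs_sub r k
      linarith
    exact mul_le_mul hr' (mul_le_of_le_one_right (Real.exp_pos _).le (invMulExpSqDeriv_le_one _))
      (by positivity) (by positivity)
  · exact Continuous.intervalIntegrable (by fun_prop) _ _
  · refine Eventually.of_forall fun t _ r _ => ?_
    have h1 := ((((hasDerivAt_momentum v r t).pow 2).div_const 2).add_const (v t)).exp
    refine h1.congr_deriv ?_
    nth_rewrite 4 [← momentum_mul_exp v r t]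
    simp only [Pi.pow_apply]
    push_cast
    ring

theorem meanMomentumDeriv_pos (hv : Continuous v) (k : ℝ) : 0 < meanMomentumDeriv v k :=
  intervalIntegral.intervalIntegral_pos_of_pos
    ((continuous_momentum_deriv hv k).intervalIntegrable _ _)
    (fun _ => mul_pos (Real.exp_pos _) (invMulExpSqDeriv_pos _)) one_pos

theorem continuous_meanMomentumDeriv (hv : Continuous v) : Continuous (meanMomentumDeriv v) := by
  refine intervalIntegral.continuous_parametric_intervalIntegral_of_continuous' ?_ _ _
  have := continuous_invMulExpSqDeriv
  fun_prop

theorem partitionFn_pos (hv : Continuous v) (k : ℝ) : 0 < partitionFn v k := by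
  have := continuous_momentum hv k
  exact intervalIntegral.intervalIntegral_pos_of_pos
    (Continuous.intervalIntegrable (by fun_prop) _ _) (fun _ => Real.exp_pos _) one_pos

theorem exists_bound_on_Icc (hv : Continuous v) : ∃ R, ∀ t ∈ Icc (0 : ℝ) 1, v t ≤ R := by
  obtain ⟨R, hR⟩ := (isCompact_Icc (a := (0 : ℝ)) (b := 1)).bddAbove_image hv.continuousOn
  exact ⟨R, fun t ht => hR (mem_image_of_mem v ht)⟩

/-- If `v ≤ R` on the period and `k ≥ 0`, then `k exp (-v) ≥ k exp (-R)`, which bounds the mean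
below. For `k ≤ 0` the inequality reverses, so the same `R` handles the limit at `-∞`. -/
theorem tendsto_meanMomentum_atTop (hv : Continuous v) :
    Tendsto (meanMomentum v) atTop atTop := by
  obtain ⟨R, hR⟩ := exists_bound_on_Icc hv
  have h1 : Tendsto (fun k => invMulExpSq (k * Real.exp (-R))) atTop atTop :=
    tendsto_invMulExpSq_atTop.comp (tendsto_id.atTop_mul_const (Real.exp_pos _))
  refine tendsto_atTop_mono' _ ?_ h1
  filter_upwards [eventually_ge_atTop 0] with k hk
  have := intervalIntegral.integral_mono_on (μ := volume) (zero_le_one' ℝ)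
    (intervalIntegrable_const (c := invMulExpSq (k * Real.exp (-R))))
    ((continuous_momentum hv k).intervalIntegrable 0 1) fun t ht =>
      monotone_invMulExpSq (mul_le_mul_of_nonneg_left
        (Real.exp_le_exp.2 (neg_le_neg (hR t ht))) hk)
  simpa [meanMomentum] using this

theorem tendsto_meanMomentum_atBot (hv : Continuous v) :
    Tendsto (meanMomentum v) atBot atBot := by
  obtain ⟨R, hR⟩ := exists_bound_on_Icc hv
  have h1 : Tendsto (fun k => invMulExpSq (k * Real.exp (-R))) atBot atBot :=
    tendsto_invMulExpSq_atBot.comp (tendsto_id.atBot_mul_const (Real.exp_pos _))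
  refine tendsto_atBot_mono' _ ?_ h1
  filter_upwards [eventually_le_atBot 0] with k hk
  have := intervalIntegral.integral_mono_on (μ := volume) (zero_le_one' ℝ)
    ((continuous_momentum hv k).intervalIntegrable 0 1)
    (intervalIntegrable_const (c := invMulExpSq (k * Real.exp (-R)))) fun t ht =>
      monotone_invMulExpSq (mul_le_mul_of_nonpos_left
        (Real.exp_le_exp.2 (neg_le_neg (hR t ht))) hk)
  simpa [meanMomentum] using this

/-- The density `exp (p ^ 2 / 2 + v) / Z` of the one-dimensional problem. -/
noncomputable def density (v : ℝ → ℝ) (k t : ℝ) : ℝ :=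
  Real.exp (momentum v k t ^ 2 / 2 + v t) / partitionFn v k

theorem density_pos (hv : Continuous v) (k t : ℝ) : 0 < density v k t :=
  div_pos (Real.exp_pos _) (partitionFn_pos hv k)

theorem continuous_density (hv : Continuous v) (k : ℝ) : Continuous (density v k) := by
  have := continuous_momentum hv k
  unfold density
  fun_prop

theorem integral_density (hv : Continuous v) (k : ℝ) : ∫ t in (0 : ℝ)..1, density v k t = 1 := by
  simp only [density, intervalIntegral.integral_div]
  exact div_self (partitionFn_pos hv k).ne'

theorem density_mul_momentum (v : ℝ → ℝ) (k t : ℝ) :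
    density v k t * momentum v k t = k / partitionFn v k := by
  rw [density, div_mul_eq_mul_div, mul_comm, momentum_mul_exp]

/-- Since the flux is constant, a larger density means a smaller `p²`. When the density at `s`
exceeds that at `t`, the kinetic terms therefore help, and only `v s - v t` remains in the exponent.
-/
theorem density_le_exp_mul_density (hv : Continuous v) (k : ℝ) {R s t : ℝ} (hR : 0 ≤ R)
    (h : v s - v t ≤ R) : density v k s ≤ Real.exp R * density v k t := by
  rcases le_total (density v k s) (density v k t) with hst | hst
  · exact hst.trans (le_mul_of_one_le_left (density_pos hv k t).le (Real.one_le_exp hR))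
  · have hp : momentum v k s ^ 2 ≤ momentum v k t ^ 2 := by
      have h1 : (density v k s * momentum v k s) ^ 2 = (density v k t * momentum v k t) ^ 2 := by
        rw [density_mul_momentum, density_mul_momentum]
      have h2 : density v k t ^ 2 ≤ density v k s ^ 2 :=
        pow_le_pow_left₀ (density_pos hv k t).le hst 2
      have h3 : 0 < density v k s ^ 2 := by have := density_pos hv k s; positivity
      rw [mul_pow, mul_pow] at h1
      nlinarith [sq_nonneg (momentum v k t)]
    rw [density, density, ← mul_div_assoc, ← Real.exp_add]
    have := partitionFn_pos hv k
    refine div_le_div_of_nonneg_right (Real.exp_le_exp.2 ?_) this.le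
    linarith

/-- Integrate the Harnack-type bound `density_le_exp_mul_density` in `s`; the total mass is one. -/
theorem exp_neg_le_density (hv : Continuous v) (k : ℝ) {R t : ℝ}
    (hR : ∀ s ∈ Icc (0 : ℝ) 1, ∀ t ∈ Icc (0 : ℝ) 1, v s - v t ≤ R) (ht : t ∈ Icc (0 : ℝ) 1) :
    Real.exp (-R) ≤ density v k t := by
  have hR0 : 0 ≤ R := by simpa using hR t ht t ht
  have := intervalIntegral.integral_mono_on (μ := volume) (zero_le_one' ℝ)
    ((continuous_density hv k).intervalIntegrable 0 1)
    (intervalIntegrable_const (c := Real.exp R * density v k t)) fun s hs =>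
      density_le_exp_mul_density hv k hR0 (hR s hs t ht)
  rw [integral_density hv] at this
  simp only [intervalIntegral.integral_const, sub_zero, one_smul] at this
  rw [Real.exp_neg, inv_le_iff_one_le_mul₀ (Real.exp_pos R)]
  linarith

/-- With `m p = c`, one has `Z ∂p/∂k = 1 / (m (1 + p²)) = m / (m² + c²)`, which is at most `m /
(e^(-2R) + c²)`. Integrating, with mass one, bounds `Z` times the mean of `∂p/∂k`, and the `c²`
cancels against the subtracted term. -/
theorem exp_le_second_derivative (hv : Continuous v) (k : ℝ) {R : ℝ}
    (hR : ∀ s ∈ Icc (0 : ℝ) 1, ∀ t ∈ Icc (0 : ℝ) 1, v s - v t ≤ R) :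
    Real.exp (-R) ^ 2 ≤
      (meanMomentumDeriv v k)⁻¹ / partitionFn v k - (k / partitionFn v k) ^ 2 := by
  have hZ := partitionFn_pos hv k
  have hD := meanMomentumDeriv_pos hv k
  set c := k / partitionFn v k with hc
  have hpt : ∀ t ∈ Icc (0 : ℝ) 1, (Real.exp (-R) ^ 2 + c ^ 2) *
      (partitionFn v k * (Real.exp (-v t) * invMulExpSqDeriv (k * Real.exp (-v t)))) ≤
        density v k t := by
    intro t ht
    have hm := density_pos hv k t
    have hlow := exp_neg_le_density hv k hR ht
    have hform : partitionFn v k * (Real.exp (-v t) * invMulExpSqDeriv (k * Real.exp (-v t))) =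
        (density v k t * (1 + momentum v k t ^ 2))⁻¹ := by
      rw [density, invMulExpSqDeriv, Real.exp_add, ← momentum, Real.exp_neg]
      field_simp
    rw [hform, ← div_eq_mul_inv, div_le_iff₀ (by positivity), hc, ← density_mul_momentum v k t]
    have h2 : Real.exp (-R) ^ 2 ≤ density v k t ^ 2 := pow_le_pow_left₀ (Real.exp_pos _).le hlow 2
    nlinarith
  have hint := intervalIntegral.integral_mono_on (μ := volume) (zero_le_one' ℝ)
    (((continuous_momentum_deriv hv k).const_mul (partitionFn v k)).const_mul
      (Real.exp (-R) ^ 2 + c ^ 2) |>.intervalIntegrable 0 1)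
    ((continuous_density hv k).intervalIntegrable 0 1) hpt
  rw [integral_density hv, intervalIntegral.integral_const_mul,
    intervalIntegral.integral_const_mul] at hint
  change _ * (_ * meanMomentumDeriv v k) ≤ _ at hint
  have : Real.exp (-R) ^ 2 + c ^ 2 ≤ (meanMomentumDeriv v k)⁻¹ / partitionFn v k := by
    rw [le_div_iff₀ hZ, ← one_div, le_div_iff₀ hD]
    linarith
  linarith

theorem exists_oneDim_solution (hv : ContDiff ℝ 1 v) (hper : Function.Periodic v 1) {R : ℝ}
    (hR : ∀ s ∈ Icc (0 : ℝ) 1, ∀ t ∈ Icc (0 : ℝ) 1, v s - v t ≤ R) :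
    ∃ h h' h'' : ℝ → ℝ, Continuous h'' ∧ (∀ L, HasDerivAt h (h' L) L) ∧
      (∀ L, HasDerivAt h' (h'' L) L) ∧ (∀ L, Real.exp (-R) ^ 2 ≤ h'' L) ∧
      ∀ L, ∃ p μ : ℝ → ℝ, ∃ c : ℝ, ContDiff ℝ 1 p ∧ ContDiff ℝ 1 μ ∧
        Function.Periodic p 1 ∧ Function.Periodic μ 1 ∧ (∀ t, 0 < μ t) ∧
        (∫ t in (0 : ℝ)..1, p t) = L ∧ (∫ t in (0 : ℝ)..1, μ t) = 1 ∧
        (∀ t, μ t * p t = c) ∧ ∀ t, p t ^ 2 / 2 + v t = Real.log (μ t) + h L := by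
  have hvc := hv.continuous
  obtain ⟨k, hkc, -, -, -, hk, hk'⟩ := exists_inverse_of_deriv_pos (hasDerivAt_meanMomentum hvc)
    (meanMomentumDeriv_pos hvc) (tendsto_meanMomentum_atTop hvc) (tendsto_meanMomentum_atBot hvc)
  have hZ := partitionFn_pos hvc
  have hD := meanMomentumDeriv_pos hvc
  -- In the variable `L` the factor `dΛ/dk` cancels, so `dZ/dL = k`; hence `h = log Z` has
  -- derivative `k / Z`.
  have hZd : ∀ L, HasDerivAt (fun L => partitionFn v (k L)) (k L) L := fun L => by
    have := (hasDerivAt_partitionFn hvc (k L)).comp L (hk' L)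
    rwa [mul_assoc, mul_inv_cancel₀ (hD _).ne', mul_one] at this
  have hZc : Continuous (fun L => partitionFn v (k L)) :=
    continuous_iff_continuousAt.2 fun L => (hZd L).continuousAt
  refine ⟨fun L => Real.log (partitionFn v (k L)), fun L => k L / partitionFn v (k L),
    fun L => (meanMomentumDeriv v (k L))⁻¹ / partitionFn v (k L) -
      (k L / partitionFn v (k L)) ^ 2, ?_, fun L => (hZd L).log (hZ _).ne', fun L => ?_,
    fun L => exp_le_second_derivative hvc (k L) hR, fun L => ?_⟩
  · have h1 := (continuous_meanMomentumDeriv hvc).comp hkc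
    refine ((h1.inv₀ fun L => (hD _).ne').div hZc fun L => (hZ _).ne').sub
      ((hkc.div hZc fun L => (hZ _).ne').pow 2)
  · have h1 := (hk' L).div (hZd L) (hZ _).ne'
    refine h1.congr_deriv ?_
    have := (hZ (k L)).ne'
    have := (hD (k L)).ne'
    field_simp
  · have hp : ContDiff ℝ 1 (momentum v (k L)) :=
      contDiff_invMulExpSq.comp (contDiff_const.mul hv.neg.exp)
    have hpp : Function.Periodic (momentum v (k L)) 1 := fun t => by
      simp only [momentum, hper t]
    refine ⟨momentum v (k L), density v (k L), k L / partitionFn v (k L), hp, ?_, hpp,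
      fun t => by simp only [density, hpp t, hper t], density_pos hvc (k L), hk L,
      integral_density hvc (k L), density_mul_momentum v (k L), fun t => ?_⟩
    · exact (((hp.pow 2).div_const 2).add hv).exp.div_const _
    · rw [density, Real.log_div (Real.exp_pos _).ne' (hZ _).ne', Real.log_exp]
      ring

end OneDim

/-! ### Integration by parts on the unit cell. -/

variable {d : ℕ}

theorem setIntegral_unitCell (f : E d → ℝ) :
    ∫ y in unitCell d, f y = ∫ z in Icc (0 : Fin d → ℝ) 1, f (WithLp.toLp 2 z) := by
  rw [← (PiLp.volume_preserving_toLp (Fin d)).setIntegral_preimage_emb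
    (MeasurableEquiv.toLp 2 (Fin d → ℝ)).measurableEmbedding f (unitCell d)]
  refine setIntegral_congr_set ?_
  have : (WithLp.toLp 2 ⁻¹' unitCell d : Set (Fin d → ℝ)) =
      Set.pi univ fun i => Ico ((0 : Fin d → ℝ) i) ((1 : Fin d → ℝ) i) := by
    ext z; simp [unitCell]
  rw [this]
  exact Measure.univ_pi_Ico_ae_eq_Icc

theorem integrableOn_unitCell {f : E d → ℝ} (hf : Continuous f) :
    IntegrableOn f (unitCell d) := by
  have hK : IsCompact (WithLp.toLp 2 '' Icc (0 : Fin d → ℝ) 1 : Set (E d)) :=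
    isCompact_Icc.image (PiLp.continuous_toLp 2 _)
  refine (hf.continuousOn.integrableOn_compact hK).mono_set fun y hy => ?_
  exact ⟨WithLp.ofLp y, ⟨fun i => (hy i).1, fun i => (hy i).2.le⟩, rfl⟩

/-- By the divergence theorem on the closed box, only face integrals remain, and those on opposite
faces cancel by periodicity. -/
theorem integral_divergence_eq_zero {F : E d → E d} (hF : ContDiff ℝ 1 F)
    (hper : CellPeriodic F) : ∫ y in unitCell d, divergence F y = 0 := by
  rcases d with _ | n
  · simp [divergence]
  have hFi : ∀ i, ContDiff ℝ 1 fun z => F z i := fun i => (contDiff_euclidean.1 hF) i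
  let L : (Fin (n + 1) → ℝ) →L[ℝ] E (n + 1) :=
    (PiLp.continuousLinearEquiv 2 ℝ fun _ : Fin (n + 1) => ℝ).symm
  have hLe : ∀ i, L (Pi.single i 1) = e i := fun i => rfl
  rw [setIntegral_unitCell]
  have key := integral_divergence_of_hasFDerivAt_off_countable' (0 : Fin (n + 1) → ℝ) 1
    zero_le_one (fun i z => F (L z) i)
    (fun i z => (fderiv ℝ (fun y => F y i) (L z)).comp L) ∅ countable_empty
    (fun i => ((hFi i).continuous.comp L.continuous).continuousOn)
    (fun z _ i => (((hFi i).differentiable one_ne_zero (L z)).hasFDerivAt).comp z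
      L.hasFDerivAt) ?_
  · refine Eq.trans ?_ (key.trans ?_)
    · rfl
    · refine Finset.sum_eq_zero fun i _ => sub_eq_zero.2 ?_
      refine integral_congr_ae (Eventually.of_forall fun x => ?_)
      have : L (i.insertNth ((1 : Fin (n + 1) → ℝ) i) x) =
          L (i.insertNth ((0 : Fin (n + 1) → ℝ) i) x) + e i := by
        rw [← hLe, ← map_add]
        congr 1
        ext j
        refine Fin.succAboveCases i ?_ (fun j => ?_) j <;> simp
      simp only [this, hper i _]
  · refine Continuous.integrableOn_Icc ?_
    refine continuous_finsetSum _ fun i _ => ?_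
    exact (((hFi i).continuous_fderiv one_ne_zero).comp L.continuous).clm_apply continuous_const

theorem sum_smul_e (y : E d) : ∑ i, y i • e i = y := by
  ext j
  simp [e, Pi.single_apply]

theorem divergence_smul {ψ : E d → ℝ} {F : E d → E d} {y : E d} (hψ : DifferentiableAt ℝ ψ y)
    (hF : DifferentiableAt ℝ F y) :
    divergence (fun z => ψ z • F z) y = ψ y * divergence F y + fderiv ℝ ψ y (F y) := by
  have hFi : ∀ i, DifferentiableAt ℝ (fun z => F z i) y := differentiableAt_euclidean.1 hF
  conv_rhs => rw [← sum_smul_e (F y)]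
  simp only [divergence, map_sum, map_smul, Finset.mul_sum, ← Finset.sum_add_distrib]
  refine Finset.sum_congr rfl fun i _ => ?_
  have : (fun z => (ψ z • F z) i) = fun z => ψ z * F z i := by ext z; simp
  rw [this, fderiv_fun_mul hψ (hFi i)]
  simp

/-- The weak form of `div F = 0`, tested against `ψ`. -/
theorem integral_fderiv_apply_eq_zero {ψ : E d → ℝ} {F : E d → E d} (hψ : ContDiff ℝ 1 ψ)
    (hF : ContDiff ℝ 1 F) (hψp : CellPeriodic ψ) (hFp : CellPeriodic F)
    (hdiv : ∀ y, divergence F y = 0) : ∫ y in unitCell d, fderiv ℝ ψ y (F y) = 0 := by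
  have hc : ContDiff ℝ 1 fun z => ψ z • F z := hψ.smul hF
  rw [← integral_divergence_eq_zero hc fun i y => by simp only [hψp i y, hFp i y]]
  refine integral_congr_ae (Eventually.of_forall fun y => ?_)
  simp only
  rw [divergence_smul (hψ.differentiable one_ne_zero y) (hF.differentiable one_ne_zero y), hdiv]
  simp

/-! ### Uniqueness of the effective Hamiltonian. -/

theorem CellPeriodic.gradient {w : E d → ℝ} (hw : CellPeriodic w) :
    CellPeriodic (gradient w) := fun i y => by
  have : (fun z => w (z + e i)) = w := funext (hw i)
  unfold _root_.gradient
  rw [← fderiv_comp_add_right, this]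

/-- The cell problem, with the regularity needed for testing the transport equation. -/
structure IsClassicalSolution (v : E d → ℝ) (Λ : E d) (w m : E d → ℝ) (h : ℝ) : Prop where
  contDiff_w : ContDiff ℝ 1 w
  periodic_w : CellPeriodic w
  continuous_m : Continuous m
  periodic_m : CellPeriodic m
  m_pos : ∀ y, 0 < m y
  contDiff_flux : ContDiff ℝ 1 fun z => m z • (Λ + gradient w z)
  hamiltonJacobi : ∀ y, ‖Λ + gradient w y‖ ^ 2 / 2 + v y = Real.log (m y) + h
  transport : ∀ y, divergence (fun z => m z • (Λ + gradient w z)) y = 0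
  mass : ∫ y in unitCell d, m y = 1

theorem IsCellSolution.isClassicalSolution {α : ℝ≥0} {v : E d → ℝ} {Λ : E d} {w m : E d → ℝ}
    {h : ℝ} (hs : IsCellSolution α v Λ w m h) : IsClassicalSolution v Λ w m h where
  contDiff_w := hs.w_holder.2.1.of_le (by norm_num)
  periodic_w := hs.w_holder.1
  continuous_m := hs.m_holder.2.1.continuous
  periodic_m := hs.m_holder.1
  m_pos := hs.m_pos
  contDiff_flux := by
    have hw : ContDiff ℝ 2 w := hs.w_holder.2.1
    have hm : ContDiff ℝ 1 m := hs.m_holder.2.1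
    have hg : ContDiff ℝ 1 (gradient w) :=
      (InnerProductSpace.toDual ℝ (E d)).symm.contDiff.comp (hw.fderiv_right (by norm_num))
    exact hm.smul (contDiff_const.add hg)
  hamiltonJacobi := hs.hamiltonJacobi
  transport := fun y => neg_eq_zero.1 (hs.transport y)
  mass := hs.mass

theorem IsClassicalSolution.exp_mul {v : E d → ℝ} {Λ : E d} {w m : E d → ℝ} {h : ℝ}
    (hs : IsClassicalSolution v Λ w m h) (y : E d) :
    Real.exp h * m y = Real.exp (‖Λ + gradient w y‖ ^ 2 / 2 + v y) := by
  rw [hs.hamiltonJacobi, Real.exp_add, Real.exp_log (hs.m_pos y), mul_comm]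

/-- The graph of the convex function `exp (|·|²/2 + r)` lies above its tangent plane at `a`. -/
theorem exp_sq_div_two_tangent_le (a b : E d) (r : ℝ) :
    Real.exp (‖a‖ ^ 2 / 2 + r) * (1 + inner ℝ (b - a) a) ≤ Real.exp (‖b‖ ^ 2 / 2 + r) := by
  have h1 : inner ℝ (b - a) a ≤ ‖b‖ ^ 2 / 2 - ‖a‖ ^ 2 / 2 := by
    have h2 := norm_sub_sq_real b a
    rw [inner_sub_left, real_inner_self_eq_norm_sq]
    nlinarith [sq_nonneg ‖b - a‖]
  have h3 := Real.add_one_le_exp (‖b‖ ^ 2 / 2 - ‖a‖ ^ 2 / 2)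
  have h4 : Real.exp (‖b‖ ^ 2 / 2 + r) =
      Real.exp (‖a‖ ^ 2 / 2 + r) * Real.exp (‖b‖ ^ 2 / 2 - ‖a‖ ^ 2 / 2) := by
    rw [← Real.exp_add]; ring_nf
  rw [h4]
  exact mul_le_mul_of_nonneg_left (by linarith) (Real.exp_pos _).le

/-- Apply the tangent inequality at `P₁` with the competitor `P₂`. As `Λ` is common, `P₂ - P₁ = ∇(w₂
- w₁)`, so the linear term is the first transport equation tested with `w₂ - w₁` and integrates to
zero. What is left is `e^h₁ ≤ e^h₂`. -/
theorem IsClassicalSolution.le {v : E d → ℝ} {Λ : E d} {w₁ m₁ w₂ m₂ : E d → ℝ} {h₁ h₂ : ℝ}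
    (hs₁ : IsClassicalSolution v Λ w₁ m₁ h₁) (hs₂ : IsClassicalSolution v Λ w₂ m₂ h₂) :
    h₁ ≤ h₂ := by
  have hψ : ContDiff ℝ 1 fun y => w₂ y - w₁ y := hs₂.contDiff_w.sub hs₁.contDiff_w
  have hweak := integral_fderiv_apply_eq_zero hψ hs₁.contDiff_flux
    (fun i y => by simp only [hs₂.periodic_w i y, hs₁.periodic_w i y])
    (fun i y => by simp only [hs₁.periodic_m i y, hs₁.periodic_w.gradient i y]) hs₁.transport
  have hcont : Continuous fun y => fderiv ℝ (fun y => w₂ y - w₁ y) y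
      (m₁ y • (Λ + gradient w₁ y)) :=
    (hψ.continuous_fderiv one_ne_zero).clm_apply hs₁.contDiff_flux.continuous
  have hpt : ∀ y, Real.exp h₁ * (m₁ y + fderiv ℝ (fun y => w₂ y - w₁ y) y
      (m₁ y • (Λ + gradient w₁ y))) ≤ Real.exp h₂ * m₂ y := by
    intro y
    have h1 : fderiv ℝ (fun y => w₂ y - w₁ y) y (Λ + gradient w₁ y) =
        inner ℝ ((Λ + gradient w₂ y) - (Λ + gradient w₁ y)) (Λ + gradient w₁ y) := by
      rw [fderiv_fun_sub (hs₂.contDiff_w.differentiable one_ne_zero y)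
        (hs₁.contDiff_w.differentiable one_ne_zero y), ← toDual_gradient, ← toDual_gradient,
        ← map_sub, InnerProductSpace.toDual_apply_apply, add_sub_add_left_eq_sub]
    have h2 := exp_sq_div_two_tangent_le (Λ + gradient w₁ y) (Λ + gradient w₂ y) (v y)
    rw [← hs₁.exp_mul, ← hs₂.exp_mul, ← h1] at h2
    rw [map_smul, smul_eq_mul]
    linarith
  have hint := integral_mono (μ := volume.restrict (unitCell d))
    ((integrableOn_unitCell (hs₁.continuous_m.add hcont)).const_mul (Real.exp h₁))
    ((integrableOn_unitCell hs₂.continuous_m).const_mul (Real.exp h₂)) hpt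
  rw [integral_const_mul, integral_const_mul, hs₂.mass] at hint
  simp only [Pi.add_apply] at hint
  rw [integral_add (integrableOn_unitCell hs₁.continuous_m) (integrableOn_unitCell hcont),
    hweak, hs₁.mass] at hint
  exact Real.exp_le_exp.1 (by linarith)

/-! ### Solutions for separable potentials. -/

theorem periodic_apply_coord {f : ℝ → ℝ} (hf : Function.Periodic f 1) (y : E d) (i j : Fin d) :
    f ((y + e i) j) = f (y j) := by
  by_cases h : j = i
  · subst h; simpa [e] using hf (y j)
  · simp [e, h]

theorem contDiff_coord {n : WithTop ℕ∞} (i : Fin d) : ContDiff ℝ n fun y : E d => y i :=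
  (EuclideanSpace.proj (𝕜 := ℝ) i).contDiff

theorem integral_prod_unitCell (f : Fin d → ℝ → ℝ) :
    ∫ y in unitCell d, ∏ i, f i (y i) = ∏ i, ∫ t in (0 : ℝ)..1, f i t := by
  rw [setIntegral_unitCell]
  have h1 : (Icc (0 : Fin d → ℝ) 1) = Set.pi univ fun _ => Icc (0 : ℝ) 1 := by
    rw [pi_univ_Icc]; rfl
  rw [h1, volume_pi, Measure.restrict_pi_pi, integral_fintype_prod_eq_prod]
  refine Finset.prod_congr rfl fun i _ => ?_
  rw [intervalIntegral.integral_of_le zero_le_one, integral_Icc_eq_integral_Ioc]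

theorem exists_periodic_primitive {p : ℝ → ℝ} (hp : Continuous p) (hper : Function.Periodic p 1)
    {L : ℝ} (hL : ∫ t in (0 : ℝ)..1, p t = L) :
    ∃ φ : ℝ → ℝ, ContDiff ℝ 1 φ ∧ Function.Periodic φ 1 ∧ ∀ t, HasDerivAt φ (p t - L) t := by
  have hc : Continuous fun t => p t - L := hp.sub continuous_const
  have hd : ∀ t, HasDerivAt (fun t => ∫ s in (0 : ℝ)..t, p s - L) (p t - L) t := fun t =>
    intervalIntegral.integral_hasDerivAt_right (hc.intervalIntegrable _ _)
      hc.aestronglyMeasurable.stronglyMeasurableAtFilter hc.continuousAt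
  refine ⟨fun t => ∫ s in (0 : ℝ)..t, p s - L, ?_, fun t => ?_, hd⟩
  · rw [contDiff_one_iff_deriv]
    refine ⟨fun t => (hd t).differentiableAt, ?_⟩
    rw [show deriv (fun t => ∫ s in (0 : ℝ)..t, p s - L) = fun t => p t - L from
      funext fun t => (hd t).deriv]
    exact hc
  · have h1 : Function.Periodic (fun t => p t - L) 1 := fun t => by simp only [hper t]
    have h2 := h1.intervalIntegral_add_eq t 0
    rw [zero_add, intervalIntegral.integral_sub (hp.intervalIntegrable 0 1)
      intervalIntegrable_const, hL] at h2
    have h3 := intervalIntegral.integral_add_adjacent_intervals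
      (hc.intervalIntegrable (μ := volume) 0 t) (hc.intervalIntegrable t (t + 1))
    rw [h2] at h3
    simpa using h3.symm

theorem hasFDerivAt_sum_coord {f f' : Fin d → ℝ → ℝ} (hf : ∀ i t, HasDerivAt (f i) (f' i t) t)
    (y : E d) : HasFDerivAt (fun y : E d => ∑ i, f i (y i))
      (∑ i, f' i (y i) • (EuclideanSpace.proj i : E d →L[ℝ] ℝ)) y := by
  refine HasFDerivAt.fun_sum fun i _ => ?_
  exact (hf i (y i)).comp_hasFDerivAt y (EuclideanSpace.proj (𝕜 := ℝ) i).hasFDerivAt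

theorem gradient_sum_coord {f f' : Fin d → ℝ → ℝ} (hf : ∀ i t, HasDerivAt (f i) (f' i t) t)
    (y : E d) : gradient (fun y : E d => ∑ i, f i (y i)) y = WithLp.toLp 2 fun i => f' i (y i) := by
  refine HasGradientAt.gradient ?_
  rw [hasGradientAt_iff_hasFDerivAt]
  refine (hasFDerivAt_sum_coord hf y).congr_fderiv ?_
  ext z
  simp [PiLp.inner_apply, mul_comm]

/-- Take `w` the sum of primitives of `p i - Λ i` and `m` the product of the `μ i`: the logarithm
turns the product into a sum, so the Hamilton–Jacobi equations add up. -/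
theorem isClassicalSolution_of_separable {v : Fin d → ℝ → ℝ} {Λ : E d} {p μ : Fin d → ℝ → ℝ}
    {c h : Fin d → ℝ} (hp : ∀ i, ContDiff ℝ 1 (p i)) (hμ : ∀ i, ContDiff ℝ 1 (μ i))
    (hpp : ∀ i, Function.Periodic (p i) 1) (hμp : ∀ i, Function.Periodic (μ i) 1)
    (hpos : ∀ i t, 0 < μ i t) (hmean : ∀ i, ∫ t in (0 : ℝ)..1, p i t = Λ i)
    (hmass : ∀ i, ∫ t in (0 : ℝ)..1, μ i t = 1) (hflux : ∀ i t, μ i t * p i t = c i)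
    (hHJ : ∀ i t, p i t ^ 2 / 2 + v i t = Real.log (μ i t) + h i) :
    ∃ w m : E d → ℝ, IsClassicalSolution (fun y => ∑ i, v i (y i)) Λ w m (∑ i, h i) := by
  choose φ hφ hφp hφd using fun i => exists_periodic_primitive (hp i).continuous (hpp i) (hmean i)
  have hgrad : ∀ y : E d, Λ + gradient (fun y : E d => ∑ i, φ i (y i)) y =
      WithLp.toLp 2 fun i => p i (y i) := fun y => by
    rw [gradient_sum_coord hφd]
    ext i
    simp
  have hm : ContDiff ℝ 1 fun y : E d => ∏ i, μ i (y i) :=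
    contDiff_prod fun i _ => (hμ i).comp (contDiff_coord i)
  have hfluxc : ContDiff ℝ 1 fun y : E d => (∏ i, μ i (y i)) •
      (WithLp.toLp 2 fun i => p i (y i) : E d) :=
    hm.smul (contDiff_euclidean.2 fun i => (hp i).comp (contDiff_coord i))
  refine ⟨fun y => ∑ i, φ i (y i), fun y => ∏ i, μ i (y i), ?_, ?_, hm.continuous, ?_, ?_, ?_,
    ?_, ?_, ?_⟩
  · exact ContDiff.sum fun i _ => (hφ i).comp (contDiff_coord i)
  · exact fun i y => Finset.sum_congr rfl fun j _ => periodic_apply_coord (hφp j) y i j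
  · exact fun i y => Finset.prod_congr rfl fun j _ => periodic_apply_coord (hμp j) y i j
  · exact fun y => Finset.prod_pos fun i _ => hpos i _
  · simpa only [hgrad] using hfluxc
  · intro y
    rw [hgrad, EuclideanSpace.norm_sq_eq, Real.log_prod fun i _ => (hpos i _).ne',
      Finset.sum_div, ← Finset.sum_add_distrib, ← Finset.sum_add_distrib]
    refine Finset.sum_congr rfl fun i _ => ?_
    simpa using hHJ i (y i)
  · intro y
    simp only [hgrad]
    refine Finset.sum_eq_zero fun i _ => ?_
    have hd := (contDiff_euclidean.1 hfluxc i).differentiable one_ne_zero y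
    -- The `i`-th flux component is `c i` times the densities in the other coordinates, hence
    -- constant along the line in direction `e i`.
    rw [← hd.lineDeriv_eq_fderiv, lineDeriv]
    have hconst : ∀ z : E d, ((∏ j, μ j (z j)) • (WithLp.toLp 2 fun j => p j (z j) : E d)) i =
        c i * ∏ j ∈ Finset.univ.erase i, μ j (z j) := fun z => by
      rw [PiLp.smul_apply, smul_eq_mul, ← Finset.mul_prod_erase _ _ (Finset.mem_univ i),
        ← hflux i (z i)]
      ring
    have : (fun t : ℝ => ((∏ j, μ j ((y + t • e i) j)) •
        (WithLp.toLp 2 fun j => p j ((y + t • e i) j) : E d)) i) =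
        fun _ => c i * ∏ j ∈ Finset.univ.erase i, μ j (y j) := by
      funext t
      rw [hconst]
      congr 1
      refine Finset.prod_congr rfl fun j hj => ?_
      simp [e, Finset.ne_of_mem_erase hj]
    rw [this, deriv_const]
  · rw [integral_prod_unitCell]
    exact Finset.prod_eq_one fun i _ => hmass i

/-! ### Second derivatives of sums of one-variable functions. -/

theorem contDiff_two_of_hasDerivAt {h h' h'' : ℝ → ℝ} (hc : Continuous h'')
    (h1 : ∀ t, HasDerivAt h (h' t) t) (h2 : ∀ t, HasDerivAt h' (h'' t) t) : ContDiff ℝ 2 h := by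
  have e1 : deriv h = h' := funext fun t => (h1 t).deriv
  have e2 : deriv h' = h'' := funext fun t => (h2 t).deriv
  have hh' : ContDiff ℝ 1 h' :=
    contDiff_one_iff_deriv.2 ⟨fun t => (h2 t).differentiableAt, e2 ▸ hc⟩
  rw [show (2 : WithTop ℕ∞) = 1 + 1 by norm_num, contDiff_succ_iff_deriv]
  exact ⟨fun t => (h1 t).differentiableAt, by simp, e1 ▸ hh'⟩

theorem secondPartial_sum_coord {f f' f'' : Fin d → ℝ → ℝ}
    (hf : ∀ i t, HasDerivAt (f i) (f' i t) t) (hf' : ∀ i t, HasDerivAt (f' i) (f'' i t) t)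
    (y : E d) (j l : Fin d) : secondPartial (fun y : E d => ∑ i, f i (y i)) y j l =
      if j = l then f'' j (y j) else 0 := by
  have h1 : fderiv ℝ (fun y : E d => ∑ i, f i (y i)) =
      fun y => ∑ i, f' i (y i) • (EuclideanSpace.proj i : E d →L[ℝ] ℝ) :=
    funext fun y => (hasFDerivAt_sum_coord hf y).fderiv
  have h2 : HasFDerivAt (fun y : E d => ∑ i, f' i (y i) • (EuclideanSpace.proj i : E d →L[ℝ] ℝ))
      (∑ i, (f'' i (y i) • (EuclideanSpace.proj i : E d →L[ℝ] ℝ)).smulRight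
        (EuclideanSpace.proj i : E d →L[ℝ] ℝ)) y := by
    refine HasFDerivAt.fun_sum fun i _ => ?_
    have h3 : HasFDerivAt (fun y : E d => f' i (y i))
        (f'' i (y i) • (EuclideanSpace.proj i : E d →L[ℝ] ℝ)) y :=
      (hf' i (y i)).comp_hasFDerivAt y (EuclideanSpace.proj (𝕜 := ℝ) i).hasFDerivAt
    exact h3.smul_const (EuclideanSpace.proj i : E d →L[ℝ] ℝ)
  rw [secondPartial, iteratedFDeriv_two_apply, h1, h2.fderiv]
  by_cases hjl : j = l
  · subst hjl; simp [e]
  · simp [e, hjl]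

/-! ### Uniformity in `x`, and the separable components. -/

theorem CellPeriodic.apply_sub_sum {X : Type*} {f : E d → X} (hf : CellPeriodic f) (n : Fin d → ℤ)
    (s : Finset (Fin d)) (x : E d) : f (x - ∑ i ∈ s, n i • e i) = f x := by
  classical
  induction s using Finset.induction_on generalizing x with
  | empty => simp
  | insert i s his ih =>
    rw [Finset.sum_insert his, ← sub_sub, ih]
    exact (hf i).sub_zsmul_eq (n i)

theorem CellPeriodic.exists_mem_unitCell {X : Type*} {f : E d → X} (hf : CellPeriodic f)
    (x : E d) : ∃ z ∈ unitCell d, f z = f x := by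
  refine ⟨x - ∑ i, ⌊x i⌋ • e i, fun j => ?_, hf.apply_sub_sum _ _ _⟩
  have : (x - ∑ i, ⌊x i⌋ • e i) j = Int.fract (x j) := by
    simp [e, Pi.single_apply]
  rw [this]
  exact ⟨Int.fract_nonneg _, Int.fract_lt_one _⟩

theorem exists_oscillation_bound {W : E d → ℝ → ℝ} (hW : Continuous fun p : E d × ℝ => W p.1 p.2)
    (hper : CellPeriodic W) :
    ∃ R, ∀ x, ∀ s ∈ Icc (0 : ℝ) 1, ∀ t ∈ Icc (0 : ℝ) 1, W x s - W x t ≤ R := by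
  have hK : IsCompact ((WithLp.toLp 2 '' Icc (0 : Fin d → ℝ) 1 : Set (E d)) ×ˢ Icc (0 : ℝ) 1) :=
    (isCompact_Icc.image (PiLp.continuous_toLp 2 _)).prod isCompact_Icc
  obtain ⟨B, hB⟩ := hK.exists_bound_of_continuousOn hW.continuousOn
  refine ⟨B + B, fun x s hs t ht => ?_⟩
  obtain ⟨z, hz, hzx⟩ := hper.exists_mem_unitCell x
  have hz' : z ∈ (WithLp.toLp 2 '' Icc (0 : Fin d → ℝ) 1 : Set (E d)) :=
    ⟨WithLp.ofLp z, ⟨fun i => (hz i).1, fun i => (hz i).2.le⟩, rfl⟩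
  have h1 := abs_le.1 (hB (z, s) ⟨hz', hs⟩)
  have h2 := abs_le.1 (hB (z, t) ⟨hz', ht⟩)
  simp only [hzx] at h1 h2
  linarith [h1.2, h2.1]

/-- Separability does not include periodicity of the summands; it follows by restricting `V` to the
`i`-th axis, where the other summands are constant and cancel. -/
theorem periodic_of_separable {V : E d → ℝ} {W : Fin d → ℝ → ℝ} (hV : CellPeriodic V)
    (h : ∀ y, V y = ∑ i, W i (y i)) (i : Fin d) : Function.Periodic (W i) 1 := fun t => by
  have h1 := hV i (t • e i)
  rw [h, h, ← Finset.add_sum_erase _ _ (Finset.mem_univ i),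
    ← Finset.add_sum_erase _ (fun j => W j ((t • e i : E d) j)) (Finset.mem_univ i),
    Finset.sum_congr rfl fun j hj => show W j ((t • e i + e i : E d) j) = W j ((t • e i : E d) j) by
      simp [e, Finset.ne_of_mem_erase hj]] at h1
  simpa [e] using add_right_cancel h1

theorem isSeparable_of_dim_one {V : E 1 → E 1 → ℝ} (hV : IsPotential V) : IsSeparable V := by
  refine ⟨fun _ x t => V x (t • e 0), fun _ => ?_, fun _ i x => ?_, fun x y => ?_⟩
  · exact hV.smooth.comp (contDiff_fst.prodMk (contDiff_snd.smul contDiff_const))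
  · simp only [hV.periodic_x i x]
  · have := sum_smul_e y
    simp only [Finset.univ_unique, Fin.default_eq_zero, Finset.sum_singleton] at this ⊢
    rw [this]

end CellProblem

theorem mainTheorem5 {d : ℕ} (V : CellProblem.E d → CellProblem.E d → ℝ)
    (hV : CellProblem.IsPotential V)
    (hsep : 1 < d → CellProblem.IsSeparable V)
    (α : ℝ≥0) (hα₀ : 0 < α) (hα₁ : α < 1)
    (w m : CellProblem.E d → CellProblem.E d → CellProblem.E d → ℝ)
    (H : CellProblem.E d → CellProblem.E d → ℝ)
    (hsol : ∀ x Λ, CellProblem.IsCellSolution α (V x) Λ (w x Λ) (m x Λ) (H x Λ)) :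
    (∀ x, ContDiff ℝ 2 (H x)) ∧
    ∃ C : ℝ, 0 < C ∧ ∀ x Λ ξ : CellProblem.E d,
      C * ‖ξ‖ ^ 2 ≤
        ∑ j : Fin d, ∑ l : Fin d, ξ j * CellProblem.secondPartial (H x) Λ j l * ξ l := by
  -- In dimension zero the space is a point, and any positive constant would do.
  rcases Nat.eq_zero_or_pos d with rfl | hd
  · refine ⟨fun x => ?_, 1, one_pos, fun x Λ ξ => ?_⟩
    · rw [show H x = fun _ => H x 0 from funext fun Λ => by rw [Subsingleton.elim Λ 0]]
      exact contDiff_const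
    · simp [Subsingleton.elim ξ 0]
  have hS : CellProblem.IsSeparable V := by
    rcases Nat.lt_or_ge 1 d with h | h
    · exact hsep h
    · obtain rfl : d = 1 := le_antisymm h hd
      exact CellProblem.isSeparable_of_dim_one hV
  obtain ⟨W, hW, hWx, hVW⟩ := hS
  choose R hR using fun i => CellProblem.exists_oscillation_bound (hW i).continuous (hWx i)
  have hW1 : ∀ x i, ContDiff ℝ 1 (W i x) := fun x i =>
    ((hW i).comp (contDiff_const.prodMk contDiff_id)).of_le (by exact_mod_cast le_top)
  have hWp : ∀ x i, Function.Periodic (W i x) 1 := fun x =>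
    CellProblem.periodic_of_separable (hV.periodic_y x) (hVW x)
  choose h h' h'' hc h1 h2 hlow hex using fun x i =>
    CellProblem.exists_oneDim_solution (hW1 x i) (hWp x i) (hR i x)
  have hH : ∀ x, H x = fun Λ => ∑ i, h x i (Λ i) := fun x => by
    funext Λ
    choose p μ c hp hμ hpp hμp hpos hmean hmass hflux hHJ using fun i => hex x i (Λ i)
    obtain ⟨w₂, m₂, hs₂⟩ := CellProblem.isClassicalSolution_of_separable hp hμ hpp hμp hpos hmean
      hmass hflux hHJ
    have hs₁ := (hsol x Λ).isClassicalSolution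
    rw [show V x = fun y => ∑ i, W i x (y i) from funext (hVW x)] at hs₁
    -- The given solution and the separable one share `V x` and `Λ`, so comparison in both
    -- directions identifies `H x Λ`.
    exact le_antisymm (hs₁.le hs₂) (hs₂.le hs₁)
  obtain ⟨B, hB⟩ : ∃ B, ∀ i, R i ≤ B :=
    ⟨∑ i, |R i|, fun i => (le_abs_self _).trans
      (Finset.single_le_sum (fun j _ => abs_nonneg (R j)) (Finset.mem_univ i))⟩
  refine ⟨fun x => ?_, Real.exp (-B) ^ 2, by positivity, fun x Λ ξ => ?_⟩
  · rw [hH x]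
    exact ContDiff.sum fun i _ => (CellProblem.contDiff_two_of_hasDerivAt (hc x i) (h1 x i)
      (h2 x i)).comp (CellProblem.contDiff_coord i)
  · simp only [hH x, CellProblem.secondPartial_sum_coord (h1 x) (h2 x), mul_ite, ite_mul, mul_zero,
      zero_mul, Finset.sum_ite_eq, Finset.mem_univ, if_true]
    rw [EuclideanSpace.norm_sq_eq, Finset.mul_sum]
    refine Finset.sum_le_sum fun i _ => ?_
    have h3 : Real.exp (-B) ^ 2 ≤ h'' x i (Λ i) :=
      (pow_le_pow_left₀ (Real.exp_pos _).le (Real.exp_le_exp.2 (neg_le_neg (hB i))) 2).trans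
        (hlow x i (Λ i))
    rw [Real.norm_eq_abs, sq_abs]
    nlinarith [mul_le_mul_of_nonneg_right h3 (sq_nonneg (ξ i))]
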